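/- A real polynomial is called hyperbolic if all its roots are real (constants, including $0$, count as hyperbolic). A sequence $\mathcal A=(\alpha_n)_{n\ge 0}$ of real numbers is a multiplier sequence if the linear operator on $\mathbb R[x]$ given by $x^i\mapsto \alpha_i x^i$ for all $i\ge 0$ sends every hyperbolic polynomial to a hyperbolic polynomial. For a polynomial $P$ all of whose nonzero roots are real and of the same sign, order its roots, with multiplicity, as $|x_1|\le |x_2|\le\dots\le |x_m|$, and define its logarithmic mesh as $$\operatorname{lmesh}(P)=\min_{1\le j\le m-1,\ x_j\ne 0}\frac{|x_{j+1}|}{|x_j|}\in[1,+\infty],$$ where the minimum over the empty set is $+\infty$ (in particular $\operatorname{lmesh}(0)=+\infty$). For a multiplier sequence $\mathcal A=(\alpha_n)_{n\ge0}$ and $k\ge 0$ let $\mathcal A_k=(\alpha_0,\dots,\alpha_k)$ be its $k$-th truncation, and let $\operatorname{lmesh}(\mathcal A_k)$ be the logarithmic mesh of the polynomial $\sum_{j=0}^k\binom kj\alpha_j t^j$. Put $$\operatorname{lmesh}(\mathcal A)=\inf_{k\ge 0}\operatorname{lmesh}(\mathcal A_k).$$ Then for any multiplier sequences $\mathcal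 A=(\alpha_n)_{n\ge 0}$ and $\mathcal B=(\beta_n)_{n\ge 0}$, the termwise product $\mathcal A\mathcal B=(\alpha_n\beta_n)_{n\ge 0}$ satisfies $$\operatorname{lmesh}(\mathcal A\mathcal B)\ge\max\bigl(\operatorname{lmesh}(\mathcal A),\operatorname{lmesh}(\mathcal B)\bigr).$$ -/

import Mathlib

open Polynomial

noncomputable section

namespace LogMesh

/-- A real polynomial is hyperbolic if all its complex roots are real, i.e. if it is a product of
linear factors and a constant over `ℝ`. Constants, including `0`, are hyperbolic. -/
def IsHyperbolic (p : ℝ[X]) : Prop := p.Splits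

/-- The linear operator on `ℝ[X]` that acts on the monomial basis by `X ^ i ↦ α i • X ^ i`. -/
def diagonalOperator (α : ℕ → ℝ) : ℝ[X] →ₗ[ℝ] ℝ[X] :=
  Polynomial.lsum fun i => α i • (Polynomial.monomial i : ℝ →ₗ[ℝ] ℝ[X])

theorem diagonalOperator_X_pow (α : ℕ → ℝ) (i : ℕ) :
    diagonalOperator α (X ^ i) = α i • X ^ i := by
  simp [diagonalOperator, Polynomial.lsum_apply, X_pow_eq_monomial, sum_monomial_index]

/-- Multiplier sequences (of the first kind): the diagonal operator preserves the set of
hyperbolic polynomials. -/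
def IsMultiplierSequence (α : ℕ → ℝ) : Prop :=
  ∀ p : ℝ[X], IsHyperbolic p → IsHyperbolic (diagonalOperator α p)

/-- The absolute values `|x₁| ≤ |x₂| ≤ …` of the real roots of `P`, listed with multiplicity in
nondecreasing order. -/
def absRoots (P : ℝ[X]) : List ℝ := (P.roots.map fun x => |x|).sort (· ≤ ·)

/-- The minimum of the quotients `y_{j+1} / y_j` of consecutive entries of a list. Quotients with
`y_j = 0` are left out; the minimum over the empty set is `⊤ = +∞`. -/
def minQuotient (L : List ℝ) : EReal :=
  ⨅ (j : ℕ) (h : j + 1 < L.length) (_ : L[j] ≠ 0), ((L[j + 1] / L[j] : ℝ) : EReal)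

/-- The logarithmic mesh of a polynomial whose roots are real and of the same sign: the minimum
of the quotients `|x_{j+1}| / |x_j|` of consecutive roots. -/
def lmesh (P : ℝ[X]) : EReal := minQuotient (absRoots P)

/-- The polynomial `∑ j, (k choose j) γ_j t ^ j` identified with the finite sequence
`γ_0, …, γ_k`; it is the image of `(1 + t) ^ k` under the diagonal operator of `γ`. -/
def finitePoly {k : ℕ} (γ : Fin (k + 1) → ℝ) : ℝ[X] :=
  ∑ j : Fin (k + 1), C ((k.choose j : ℝ) * γ j) * X ^ (j : ℕ)

/-- The logarithmic mesh of a finite multiplier sequence of length `k + 1`. -/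
def lmeshFinite {k : ℕ} (γ : Fin (k + 1) → ℝ) : EReal := lmesh (finitePoly γ)

/-- The `k`-th truncation of `α`: its initial segment of length `k + 1`. -/
def truncation (α : ℕ → ℝ) (k : ℕ) : Fin (k + 1) → ℝ := fun j => α j

/-- The logarithmic mesh of an infinite multiplier sequence. -/
def lmeshSeq (α : ℕ → ℝ) : EReal := ⨅ k : ℕ, lmeshFinite (truncation α k)

end LogMesh

end

open Polynomial

namespace LogMesh

/-! The logarithmic mesh can be read off from pencils. Let the roots of `P` have one sign. If
consecutive nonzero roots have quotients exceeding `r > 1`, then the roots of `P(x)` and `P(r x)`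
interlace, so all their linear combinations are hyperbolic (`splits_pencil_of_separated`).
Conversely, if these pencils are hyperbolic for all `1 < r < q`, the quotients are at least `q`
(`separated_of_splits_pencil`, resting on the Obreschkoff-type lemma `exists_root_between`).

A diagonal operator is linear and commutes with `x ↦ r x`, so a multiplier sequence maps pencils of
this kind to pencils of this kind and cannot decrease the mesh (`lmesh_le_lmesh_diagonalOperator`).
The polynomial of a truncation of `A B` is the image under `B` of that of `A`. The one-sign
condition holds because the entries of a multiplier sequence have constant or alternating sign
(`IsMultiplierSequence.exists_sign`). -/

/-! ### Laguerre's identity and pencils of hyperbolic polynomials -/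

theorem eval_laguerre_prod (s : Multiset ℝ) (t : ℝ) (h : ∀ r ∈ s, t ≠ r) :
    (derivative (s.map fun r => X - C r).prod).eval t ^ 2 -
      (s.map fun r => X - C r).prod.eval t *
        (derivative (derivative (s.map fun r => X - C r).prod)).eval t =
      (s.map fun r => X - C r).prod.eval t ^ 2 * (s.map fun r => ((t - r) ^ 2)⁻¹).sum := by
  induction s using Multiset.induction_on with
  | empty => simp
  | cons a s ih =>
    have ih := ih fun r hr => h r (Multiset.mem_cons_of_mem hr)
    have ha : t - a ≠ 0 := sub_ne_zero.2 (h a (Multiset.mem_cons_self a s))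
    simp only [Multiset.map_cons, Multiset.prod_cons, Multiset.sum_cons, derivative_mul,
      derivative_add, eval_mul, eval_add, eval_sub, eval_X, eval_C, derivative_sub, derivative_X,
      derivative_C, sub_zero, one_mul] at ih ⊢
    generalize eval t (s.map fun r => X - C r).prod = p at *
    generalize eval t (derivative (s.map fun r => X - C r).prod) = p' at *
    generalize eval t (derivative (derivative (s.map fun r => X - C r).prod)) = p'' at *
    generalize (s.map fun r => ((t - r) ^ 2)⁻¹).sum = S at *
    have e : ((t - a) * p) ^ 2 * (((t - a) ^ 2)⁻¹ + S) = p ^ 2 + (t - a) ^ 2 * (p ^ 2 * S) := by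
      field_simp
    rw [e, ← ih]
    ring

/-- Laguerre's identity for a polynomial with only real roots. -/
theorem eval_laguerre {p : ℝ[X]} (hp : p.Splits) {t : ℝ} (ht : p.eval t ≠ 0) :
    (derivative p).eval t ^ 2 - p.eval t * (derivative (derivative p)).eval t =
      p.eval t ^ 2 * (p.roots.map fun r => ((t - r) ^ 2)⁻¹).sum := by
  have h0 : p ≠ 0 := by rintro rfl; simp at ht
  have h : ∀ r ∈ p.roots, t ≠ r := by
    rintro r hr rfl
    exact ht ((mem_roots h0).1 hr)
  have key := eval_laguerre_prod p.roots t h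
  have e := hp.eq_prod_roots
  have e0 : p.eval t = p.leadingCoeff * ((p.roots.map fun a => X - C a).prod).eval t := by
    conv_lhs => rw [e]
    simp
  have e1 : (derivative p).eval t =
      p.leadingCoeff * (derivative (p.roots.map fun a => X - C a).prod).eval t := by
    conv_lhs => rw [e]
    simp
  have e2 : (derivative (derivative p)).eval t =
      p.leadingCoeff * (derivative (derivative (p.roots.map fun a => X - C a).prod)).eval t := by
    conv_lhs => rw [e]
    simp
  rw [e0, e1, e2]
  linear_combination p.leadingCoeff ^ 2 * key

/-- By Laguerre's identity `K` bounds the sum of `(t - r)⁻²` over the roots, so each root is at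
distance at least `1 / √K` from `t`; this bounds every factor `|s - r|` by a multiple of `|t - r|`.
-/
theorem abs_eval_le_of_laguerre_le {p : ℝ[X]} (hp : p.Splits) {t K : ℝ} (ht : p.eval t ≠ 0)
    (hK : (derivative p).eval t ^ 2 - p.eval t * (derivative (derivative p)).eval t ≤
      p.eval t ^ 2 * K) (s : ℝ) :
    |p.eval s| ≤ |p.eval t| * (1 + |s - t| * √K) ^ p.natDegree := by
  have h0 : p ≠ 0 := by rintro rfl; simp at ht
  have hr : ∀ r ∈ p.roots, t - r ≠ 0 := by
    intro r hr h
    rw [sub_eq_zero.1 h] at ht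
    exact ht ((mem_roots h0).1 hr)
  rw [eval_laguerre hp ht] at hK
  have hsum := le_of_mul_le_mul_left hK (by positivity)
  have hfac : ∀ r ∈ p.roots, |s - r| ≤ |t - r| * (1 + |s - t| * √K) := by
    intro r hrr
    have h1 : ((t - r) ^ 2)⁻¹ ≤ K := by
      refine le_trans (Multiset.single_le_sum ?_ _
        (Multiset.mem_map_of_mem (fun r => ((t - r) ^ 2)⁻¹) hrr)) hsum
      intro x hx
      obtain ⟨y, -, rfl⟩ := Multiset.mem_map.1 hx
      positivity
    have h2 : |t - r|⁻¹ ≤ √K := by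
      apply Real.le_sqrt_of_sq_le
      rwa [inv_pow, sq_abs]
    have h3 : 0 < |t - r| := abs_pos.2 (hr r hrr)
    have h4 : 1 ≤ |t - r| * √K := by
      calc 1 = |t - r| * |t - r|⁻¹ := (mul_inv_cancel₀ h3.ne').symm
        _ ≤ _ := by gcongr
    calc |s - r| = |(t - r) + (s - t)| := by ring_nf
      _ ≤ |t - r| + |s - t| := abs_add_le _ _
      _ ≤ |t - r| + |s - t| * (|t - r| * √K) := by nlinarith [abs_nonneg (s - t)]
      _ = _ := by ring
  rw [hp.eval_eq_prod_roots s, hp.eval_eq_prod_roots t, hp.natDegree_eq_card_roots, abs_mul,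
    abs_mul, mul_assoc]
  gcongr
  revert hfac
  generalize p.roots = m
  intro hfac
  induction m using Multiset.induction_on with
  | empty => simp
  | cons a m ih =>
    have h1 := hfac a (Multiset.mem_cons_self a m)
    have h2 := ih fun r hr => hfac r (Multiset.mem_cons_of_mem hr)
    simp only [Multiset.map_cons, Multiset.prod_cons, abs_mul, Multiset.card_cons]
    calc _ ≤ (|t - a| * (1 + |s - t| * √K)) * _ := mul_le_mul h1 h2 (abs_nonneg _) (by positivity)
      _ = _ := by ring

/-- In a pencil of hyperbolic polynomials, a member with a double root at `t` vanishes
if some other member does not vanish at `t`. -/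
theorem eq_zero_of_double_root {F D : ℝ[X]} (h : ∀ c : ℝ, (D + C c * F).Splits) {t : ℝ}
    (h0 : D.eval t = 0) (h1 : (derivative D).eval t = 0) (hF : F.eval t ≠ 0) : D = 0 := by
  -- With this sign, the cross term `-σ δ F(t) D''(t)` in the Laguerre expression of `D + σ δ F` at
  -- `t` is nonpositive. The same `K` then works for all `δ > 0`, the growth bound at `s` is `O(δ)`,
  -- and `δ → 0` gives `D(s) = 0`.
  obtain ⟨σ, hσ, hs⟩ : ∃ σ : ℝ, (σ = 1 ∨ σ = -1) ∧
      0 ≤ σ * (F.eval t * (derivative (derivative D)).eval t) := by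
    rcases le_total 0 (F.eval t * (derivative (derivative D)).eval t) with h | h
    · exact ⟨1, .inl rfl, by simpa using h⟩
    · exact ⟨-1, .inr rfl, by simpa using h⟩
  have hσ0 : σ ≠ 0 := by rcases hσ with rfl | rfl <;> norm_num
  have hσ1 : |σ| = 1 := by rcases hσ with rfl | rfl <;> norm_num
  set K : ℝ := ((derivative F).eval t ^ 2 - F.eval t * (derivative (derivative F)).eval t) /
    F.eval t ^ 2 with hK
  refine Polynomial.funext fun s => ?_
  set M : ℝ := |F.eval t| * (1 + |s - t| * √K) ^ max D.natDegree F.natDegree + |F.eval s| with hM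
  have key : ∀ δ : ℝ, 0 < δ → |D.eval s| ≤ δ * M := by
    intro δ hδ
    have hev : (D + C (σ * δ) * F).eval t = σ * δ * F.eval t := by simp [h0]
    have := abs_eval_le_of_laguerre_le (K := K) (h (σ * δ)) (t := t)
      (by rw [hev]; positivity) (by
        have hF2 : F.eval t ^ 2 * K =
            (derivative F).eval t ^ 2 - F.eval t * (derivative (derivative F)).eval t := by
          rw [hK]; field_simp
        rw [hev]
        simp only [derivative_add, derivative_mul, derivative_C, zero_mul, zero_add, eval_add,
          eval_mul, eval_C, h1]
        have e : (σ * δ * F.eval t) ^ 2 * K = (σ * δ) ^ 2 * (F.eval t ^ 2 * K) := by ring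
        rw [e, hF2]
        nlinarith [mul_nonneg hδ.le hs]) s
    rw [hev] at this
    have hdeg : (D + C (σ * δ) * F).natDegree ≤ max D.natDegree F.natDegree :=
      (natDegree_add_le _ _).trans (max_le_max le_rfl (natDegree_C_mul_le _ _))
    have hpow : (1 + |s - t| * √K) ^ (D + C (σ * δ) * F).natDegree ≤
        (1 + |s - t| * √K) ^ max D.natDegree F.natDegree :=
      pow_le_pow_right₀ (by nlinarith [mul_nonneg (abs_nonneg (s - t)) (Real.sqrt_nonneg K)]) hdeg
    have e1 : D.eval s = (D + C (σ * δ) * F).eval s - σ * δ * F.eval s := by simp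
    rw [e1]
    refine (abs_sub _ _).trans ?_
    rw [abs_mul, abs_mul, hσ1, abs_of_pos hδ, one_mul] at *
    calc _ ≤ δ * |F.eval t| * (1 + |s - t| * √K) ^ max D.natDegree F.natDegree
          + δ * |F.eval s| := by gcongr; exact this.trans (by gcongr)
      _ = _ := by rw [hM]; ring
  have hlim : Filter.Tendsto (fun δ : ℝ => δ * M) (nhdsWithin 0 (Set.Ioi 0)) (nhds 0) := by
    have : Filter.Tendsto (fun δ : ℝ => δ * M) (nhds 0) (nhds (0 * M)) :=
      (continuous_id.mul continuous_const).tendsto 0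
    rw [zero_mul] at this
    exact this.mono_left nhdsWithin_le_nhds
  have := ge_of_tendsto hlim (b := |D.eval s|)
    (by filter_upwards [self_mem_nhdsWithin] with δ hδ using key δ hδ)
  simpa using this

/-- A pencil form of Obreschkoff's theorem: between two roots of one member of a pencil of
hyperbolic polynomials lies a root of every other member. -/
theorem exists_root_between {F G : ℝ[X]} (h : ∀ c : ℝ, (G + C c * F).Splits) {u v : ℝ}
    (huv : u ≤ v) (hdvd : (X - C u) * (X - C v) ∣ G) (hG : G ≠ 0) :
    ∃ x ∈ Set.Icc u v, F.eval x = 0 := by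
  by_contra! hF
  obtain ⟨H, rfl⟩ := hdvd
  rcases huv.eq_or_lt with rfl | huv
  · exact hG (eq_zero_of_double_root h (t := u) (by simp) (by simp) (hF u (by simp)))
  · set G := (X - C u) * (X - C v) * H with hGdef
    have hGu : G.eval u = 0 := by simp [hGdef]
    have hGv : G.eval v = 0 := by simp [hGdef]
    -- Rolle for `G / F`: at a critical point `t` with value `c`, the member `G - c F` has a double
    -- root, hence is zero. Evaluating at `u` forces `c = 0`, so `G = 0`.
    obtain ⟨t, ht, h0⟩ := exists_hasDerivAt_eq_zero (f := fun x => G.eval x / F.eval x)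
      (f' := fun x => ((derivative G).eval x * F.eval x - G.eval x * (derivative F).eval x) /
        F.eval x ^ 2) huv
      (ContinuousOn.div G.continuous.continuousOn F.continuous.continuousOn hF)
      (by simp [hGu, hGv])
      (fun x hx => (G.hasDerivAt x).div (F.hasDerivAt x) (hF x (Set.Ioo_subset_Icc_self hx)))
    have hFt := hF t (Set.Ioo_subset_Icc_self ht)
    have h0 : (derivative G).eval t * F.eval t - G.eval t * (derivative F).eval t = 0 := by
      rcases div_eq_zero_iff.1 h0 with h | h
      · exact h
      · exact absurd h (pow_ne_zero 2 hFt)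
    set c := G.eval t / F.eval t with hc
    have hcF : c * F.eval t = G.eval t := div_mul_cancel₀ _ hFt
    have hD : G + C (-c) * F = 0 := by
      refine eq_zero_of_double_root (F := F) (t := t) (fun d => ?_) ?_ ?_ hFt
      · have : G + C (-c) * F + C d * F = G + C (-c + d) * F := by rw [C_add]; ring
        rw [this]
        exact h _
      · simp [hcF]
      · have : ((derivative G).eval t - c * (derivative F).eval t) * F.eval t = 0 := by
          rw [← h0, ← hcF]; ring
        simpa [sub_eq_add_neg] using (mul_eq_zero.1 this).resolve_right hFt
    have hcu : c = 0 := by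
      have := congrArg (eval u) hD
      simpa [hGu, hF u (by simp [huv.le])] using this
    rw [hcu] at hD
    exact hG (by simpa using hD)


/-! ### Separation of roots versus hyperbolicity of the pencil of `P(x)` and `P(q x)` -/

theorem splits_of_natDegree_le_card_roots_add_one {p : ℝ[X]}
    (h : p.natDegree ≤ p.roots.card + 1) : p.Splits := by
  obtain ⟨g, hg, hcard, -⟩ := exists_prod_multiset_X_sub_C_mul p
  rw [← hg]
  refine Splits.mul (Splits.multisetProd fun f hf => ?_) (Splits.of_natDegree_le_one (by omega))
  obtain ⟨a, -, rfl⟩ := Multiset.mem_map.1 hf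
  exact Splits.X_sub_C a

theorem exists_root_of_eval_mul_neg {f : ℝ → ℝ} (hf : Continuous f) {a b : ℝ} (hab : a < b)
    (h : f a * f b < 0) : ∃ x ∈ Set.Ioo a b, f x = 0 := by
  rcases mul_neg_iff.1 h with ⟨h1, h2⟩ | ⟨h1, h2⟩
  · exact intermediate_value_Ioo' hab.le hf.continuousOn ⟨h2, h1⟩
  · exact intermediate_value_Ioo hab.le hf.continuousOn ⟨h1, h2⟩

theorem sq_eq_one_of_sign {σ : ℝ} (hσ : σ = 1 ∨ σ = -1) : σ * σ = 1 := by
  rcases hσ with rfl | rfl <;> norm_num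

/-- At the roots of `P(q x)` the combination reduces to `c P`, which changes sign between
consecutive ones. This yields `n - 1` real roots in degree at most `n`, so the last one is real too.
-/
theorem splits_pencil_of_separated_of_pos {q σ : ℝ} (hq : 1 < q) (hσ : σ = 1 ∨ σ = -1) {n : ℕ}
    {e : Fin n → ℝ} (hpos : ∀ i, 0 < e i) (hsep : ∀ i j, i < j → q * e i < e j) (c d : ℝ) :
    (C c * ∏ i, (X - C (σ * e i)) +
      C d * (∏ i, (X - C (σ * e i))).comp (C q * X)).Splits := by
  have hq0 : 0 < q := by linarith
  have hσσ := sq_eq_one_of_sign hσ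
  set P : ℝ[X] := ∏ i, (X - C (σ * e i)) with hP
  have hPs : P.Splits := Splits.prod fun i _ => Splits.X_sub_C _
  have hlin : (C q * X : ℝ[X]).natDegree ≤ 1 := (natDegree_C_mul_le q X).trans natDegree_X_le
  have hPdeg : P.natDegree = n := by
    rw [hP, natDegree_prod_of_monic _ _ fun i _ => monic_X_sub_C _]
    simp only [natDegree_X_sub_C, Finset.sum_const, Finset.card_univ, Fintype.card_fin, smul_eq_mul,
      mul_one]
  rcases eq_or_ne c 0 with rfl | hc
  · simpa using (hPs.comp_of_natDegree_le_one hlin).C_mul d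
  set F := C c * P + C d * P.comp (C q * X) with hF
  have hFdeg : F.natDegree ≤ n := by
    refine natDegree_add_le_of_degree_le ((natDegree_C_mul_le _ _).trans hPdeg.le)
      ((natDegree_C_mul_le _ _).trans (natDegree_comp_le.trans ?_))
    rw [hPdeg]
    nlinarith
  obtain _ | m := n
  · exact Splits.of_natDegree_eq_zero (by omega)
  rcases eq_or_ne F 0 with h0 | hF0
  · rw [h0]; exact Splits.zero
  have hmono : StrictMono e := fun i j hij => by nlinarith [hsep i j hij, hpos i]
  have hroot : ∀ j : Fin m, ∃ y ∈ Set.Ioo (e j.castSucc / q) (e j.succ / q),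
      F.eval (σ * y) = 0 := by
    intro j
    refine exists_root_of_eval_mul_neg (f := fun y => F.eval (σ * y))
      (F.continuous.comp (continuous_const.mul continuous_id))
      (div_lt_div_of_pos_right (hmono j.castSucc_lt_succ) hq0) ?_
    have hval : ∀ i, F.eval (σ * (e i / q)) = c * P.eval (σ * (e i / q)) := by
      intro i
      have : P.eval (q * (σ * (e i / q))) = 0 := by
        rw [hP, eval_prod]
        refine Finset.prod_eq_zero (Finset.mem_univ i) ?_
        simp only [eval_sub, eval_X, eval_C]
        field_simp
        ring
      simp [hF, this]
    have hprod : P.eval (σ * (e j.castSucc / q)) * P.eval (σ * (e j.succ / q)) < 0 := by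
      rw [hP, eval_prod, eval_prod, ← Finset.prod_mul_distrib]
      have e1 : ∀ i, eval (σ * (e j.castSucc / q)) (X - C (σ * e i)) *
          eval (σ * (e j.succ / q)) (X - C (σ * e i)) =
          (e j.castSucc / q - e i) * (e j.succ / q - e i) := by
        intro i
        simp only [eval_sub, eval_X, eval_C]
        linear_combination ((e j.castSucc / q - e i) * (e j.succ / q - e i)) * hσσ
      simp only [e1]
      have hself : ∀ i, e i / q < e i := fun i => div_lt_self (hpos i) hq
      have hnext : ∀ i k, i < k → e i < e k / q := fun i k h => by
        rw [lt_div_iff₀ hq0, mul_comm]; exact hsep i k h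
      -- Only the factor of index `j.castSucc` is negative: in absolute value, its root is the only
      -- one between the two points.
      rw [← Finset.mul_prod_erase _ _ (Finset.mem_univ j.castSucc)]
      refine mul_neg_of_neg_of_pos (mul_neg_of_neg_of_pos ?_ ?_) (Finset.prod_pos fun i hi => ?_)
      · linarith [hself j.castSucc]
      · linarith [hnext _ _ j.castSucc_lt_succ]
      · rcases lt_or_gt_of_ne (Finset.ne_of_mem_erase hi) with h | (h : j.castSucc < i)
        · exact mul_pos (by linarith [hnext _ _ h])
            (by linarith [hnext _ _ (h.trans j.castSucc_lt_succ)])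
        · have h' : j.succ ≤ i := by
            rw [Fin.le_def]; rw [Fin.lt_def] at h; simpa using h
          exact mul_pos_of_neg_of_neg (by linarith [hself j.castSucc, hmono h])
            (by linarith [hself j.succ, hmono.monotone h'])
    show F.eval _ * F.eval _ < 0
    rw [hval, hval]
    nlinarith [mul_self_pos.2 hc]
  choose y hy hy0 using hroot
  have hyinj : Function.Injective fun j => σ * y j := by
    have hys : StrictMono y := by
      intro j k hjk
      refine (hy j).2.trans_le (le_trans ?_ (hy k).1.le)
      have : j.succ ≤ k.castSucc := by
        rw [Fin.le_def]; rw [Fin.lt_def] at hjk; simpa using hjk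
      gcongr
      exact hmono.monotone this
    intro j k hjk
    refine hys.injective (mul_left_cancel₀ (a := σ) ?_ hjk)
    rintro rfl
    simp at hσσ
  have hcard : m ≤ F.roots.card := by
    calc m = (Finset.univ.image fun j => σ * y j).card := by
          rw [Finset.card_image_of_injective _ hyinj]; simp
      _ ≤ F.roots.toFinset.card := by
          refine Finset.card_le_card fun x hx => ?_
          obtain ⟨j, -, rfl⟩ := Finset.mem_image.1 hx
          rw [Multiset.mem_toFinset, mem_roots hF0]
          exact hy0 j
      _ ≤ _ := Multiset.toFinset_card_le _
  exact splits_of_natDegree_le_card_roots_add_one (by omega)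

/-- If the roots of `P` are of one sign and the quotients of consecutive nonzero roots exceed `q`,
then the pencil spanned by `P(x)` and `P(q x)` consists of hyperbolic polynomials. -/
theorem splits_pencil_of_separated {q σ : ℝ} (hq : 1 < q) (hσ : σ = 1 ∨ σ = -1) {n : ℕ}
    {e : Fin n → ℝ} (hnonneg : ∀ i, 0 ≤ e i) (hmono : Monotone e)
    (hsep : ∀ i j, i < j → e i ≠ 0 → q * e i < e j) (c d : ℝ) :
    (C c * ∏ i, (X - C (σ * e i)) +
      C d * (∏ i, (X - C (σ * e i))).comp (C q * X)).Splits := by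
  induction n generalizing c d with
  | zero =>
    exact splits_pencil_of_separated_of_pos hq hσ (fun i => i.elim0) (fun i => i.elim0) c d
  | succ n ih =>
    rcases (hnonneg 0).eq_or_lt with h0 | h0
    · have := ih (e := fun i => e i.succ) (fun i => hnonneg _)
        (fun i j h => hmono (Fin.succ_le_succ_iff.2 h))
        (fun i j h => hsep _ _ (Fin.succ_lt_succ_iff.2 h)) c (d * q)
      rw [Fin.prod_univ_succ, ← h0]
      have e1 : ∀ R : ℝ[X], C c * ((X - C (σ * 0)) * R) +
          C d * ((X - C (σ * 0)) * R).comp (C q * X) =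
          X * (C c * R + C (d * q) * R.comp (C q * X)) := by
        intro R
        simp only [mul_zero, C_0, sub_zero, mul_comp, X_comp, C_mul]
        ring
      rw [e1]
      exact Splits.X.mul this
    · have hpos : ∀ i, 0 < e i := fun i => h0.trans_le (hmono (Fin.zero_le i))
      exact splits_pencil_of_separated_of_pos hq hσ hpos
        (fun i j h => hsep i j h (hpos i).ne') c d

/-- Strong induction on `i`. If `e j < q * e i`, pick `r` with `e j / e i < r < q`. Between the
roots `e i / r` and `e j / r` of `Q(r x)` (up to sign) lies a root `e k` of `Q`, and `e k < e i`.
Then the pair `k, i` already violates the bound. -/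
theorem separated_of_splits_pencil {q σ l : ℝ} (hσ : σ = 1 ∨ σ = -1) (hl : l ≠ 0)
    {n : ℕ} {e : Fin n → ℝ} (hnonneg : ∀ i, 0 ≤ e i) (hmono : Monotone e) {Q : ℝ[X]}
    (hQ : Q = C l * ∏ i, (X - C (σ * e i)))
    (h : ∀ r, 1 < r → r < q → ∀ c : ℝ, (Q.comp (C r * X) + C c * Q).Splits)
    (i : Fin n) : ∀ j, i < j → e i ≠ 0 → q * e i ≤ e j := by
  have hσσ := sq_eq_one_of_sign hσ
  have hσ0 : σ ≠ 0 := by rintro rfl; simp at hσσ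
  induction i using WellFoundedLT.induction with
  | ind i ih =>
  intro j hij hi0
  by_contra! hlt
  have hipos : 0 < e i := lt_of_le_of_ne (hnonneg i) (Ne.symm hi0)
  have hle : e i ≤ e j := hmono hij.le
  obtain ⟨r, hr1, hr2⟩ := exists_between ((div_lt_iff₀ hipos).2 hlt)
  have hr : 1 < r := lt_of_le_of_lt ((one_le_div hipos).2 hle) hr1
  have hr0 : 0 < r := by linarith
  have hQ0 : Q ≠ 0 := by
    rw [hQ]
    exact mul_ne_zero (C_ne_zero.2 hl) (Finset.prod_ne_zero_iff.2 fun k _ => X_sub_C_ne_zero _)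
  have hG0 : Q.comp (C r * X) ≠ 0 := by
    intro h0
    apply hQ0
    have := congrArg (fun p => p.comp (C r⁻¹ * X)) h0
    simp only [comp_assoc, mul_comp, C_comp, X_comp, zero_comp] at this
    rwa [← mul_assoc, ← C_mul, mul_inv_cancel₀ hr0.ne', C_1, one_mul, comp_X] at this
  have hdvd : (X - C (σ * (e i / r))) * (X - C (σ * (e j / r))) ∣ Q.comp (C r * X) := by
    have h1 : (X - C (σ * e i)) * (X - C (σ * e j)) ∣ Q := by
      rw [hQ, ← Finset.prod_pair (f := fun k => X - C (σ * e k)) hij.ne]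
      exact (Finset.prod_dvd_prod_of_subset _ _ _ (Finset.subset_univ _)).mul_left _
    obtain ⟨R, hR⟩ := h1
    refine ⟨C r * C r * R.comp (C r * X), ?_⟩
    have h2 : ∀ k, (C r * X - C (σ * e k) : ℝ[X]) = C r * (X - C (σ * (e k / r))) := by
      intro k
      rw [mul_sub, ← C_mul]
      congr 2
      field_simp
    rw [hR]
    rw [mul_comp, mul_comp, sub_comp, sub_comp, X_comp, C_comp, C_comp, h2, h2]
    ring
  obtain ⟨y, hy1, hy2, hy0⟩ : ∃ y, e i / r ≤ y ∧ y ≤ e j / r ∧ Q.eval (σ * y) = 0 := by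
    have hle' : e i / r ≤ e j / r := by gcongr
    rcases hσ with rfl | rfl
    · simp only [one_mul] at hdvd
      obtain ⟨x, hx, hx0⟩ := exists_root_between (h r hr hr2) hle' hdvd hG0
      exact ⟨x, hx.1, hx.2, by simpa using hx0⟩
    · rw [mul_comm] at hdvd
      obtain ⟨x, hx, hx0⟩ := exists_root_between (h r hr hr2) (by linarith) hdvd hG0
      exact ⟨-x, by linarith [hx.2], by linarith [hx.1], by simpa using hx0⟩
  obtain ⟨k, hk⟩ : ∃ k, e k = y := by
    rw [hQ, eval_mul, eval_C, eval_prod] at hy0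
    obtain ⟨k, -, hk⟩ := Finset.prod_eq_zero_iff.1 ((mul_eq_zero.1 hy0).resolve_left hl)
    simp only [eval_sub, eval_X, eval_C] at hk
    exact ⟨k, (mul_left_cancel₀ hσ0 (sub_eq_zero.1 hk)).symm⟩
  subst hk
  have hki : e k < e i := hy2.trans_lt <| by
    rw [div_lt_iff₀ hr0, mul_comm]
    exact (div_lt_iff₀ hipos).1 hr1
  have hk0 : 0 < e k := (div_pos hipos hr0).trans_le hy1
  -- The contradiction is `q * e k ≤ e i ≤ r * e k` with `r < q` and `e k > 0`.
  have := ih k (hmono.reflect_lt hki) i (hmono.reflect_lt hki) hk0.ne'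
  have h3 : e i ≤ e k * r := (div_le_iff₀ hr0).1 hy1
  nlinarith


/-! ### Algebra of diagonal operators -/

theorem coeff_diagonalOperator (α : ℕ → ℝ) (p : ℝ[X]) (i : ℕ) :
    (diagonalOperator α p).coeff i = α i * p.coeff i := by
  induction p using Polynomial.induction_on' with
  | add p q hp hq => rw [map_add, coeff_add, hp, hq, coeff_add, mul_add]
  | monomial n a =>
    rw [diagonalOperator, Polynomial.lsum_apply, sum_monomial_index _ _ (by simp)]
    by_cases h : n = i
    · subst h; simp
    · simp [coeff_monomial, h]

theorem diagonalOperator_comp_C_mul_X (α : ℕ → ℝ) (p : ℝ[X]) (q : ℝ) :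
    diagonalOperator α (p.comp (C q * X)) = (diagonalOperator α p).comp (C q * X) := by
  ext i
  simp only [coeff_diagonalOperator, comp_C_mul_X_coeff, mul_assoc]

theorem diagonalOperator_diagonalOperator (α β : ℕ → ℝ) (p : ℝ[X]) :
    diagonalOperator β (diagonalOperator α p) = diagonalOperator (fun n => α n * β n) p := by
  ext i
  simp only [coeff_diagonalOperator]
  ring

theorem IsMultiplierSequence.mul {α β : ℕ → ℝ} (hα : IsMultiplierSequence α)
    (hβ : IsMultiplierSequence β) : IsMultiplierSequence fun n => α n * β n := fun p hp => by
  rw [← diagonalOperator_diagonalOperator]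
  exact hβ _ (hα _ hp)

theorem finitePoly_truncation (α : ℕ → ℝ) (k : ℕ) :
    finitePoly (truncation α k) = diagonalOperator α ((1 + X) ^ k) := by
  ext i
  rw [coeff_diagonalOperator, coeff_one_add_X_pow, finitePoly, finsetSum_coeff]
  simp only [coeff_C_mul, coeff_X_pow, truncation]
  by_cases h : i < k + 1
  · rw [Finset.sum_eq_single (⟨i, h⟩ : Fin (k + 1))]
    · simp [mul_comm]
    · intro j _ hj
      have : i ≠ (j : ℕ) := fun h' => hj (Fin.ext h'.symm)
      simp [this]
    · simp
  · rw [Nat.choose_eq_zero_of_lt (by omega)]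
    simp only [Nat.cast_zero, mul_zero]
    refine Finset.sum_eq_zero fun j _ => ?_
    have : i ≠ (j : ℕ) := by have := j.2; omega
    simp [this]

theorem splits_one_add_X_pow (k : ℕ) : ((1 + X : ℝ[X]) ^ k).Splits := by
  rw [add_comm, ← C_1]
  exact (Splits.X_add_C 1).pow k

theorem IsMultiplierSequence.splits_finitePoly {α : ℕ → ℝ} (hα : IsMultiplierSequence α) (k : ℕ) :
    (finitePoly (truncation α k)).Splits := by
  rw [finitePoly_truncation]
  exact hα _ (splits_one_add_X_pow k)

theorem IsMultiplierSequence.shift {α : ℕ → ℝ} (hα : IsMultiplierSequence α) (n : ℕ) :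
    IsMultiplierSequence fun i => α (n + i) := by
  induction n with
  | zero => simpa using hα
  | succ n ih =>
    intro p hp
    have h := ih _ (Splits.X.mul hp)
    have e : diagonalOperator (fun i => α (n + i)) (X * p) =
        X * diagonalOperator (fun i => α (n + 1 + i)) p := by
      ext i
      cases i with
      | zero => simp [coeff_diagonalOperator]
      | succ i => simp [coeff_diagonalOperator, coeff_X_mul, add_assoc, add_comm 1 i]
    rw [e] at h
    exact splits_X_mul.1 h

/-! ### Sign patterns of multiplier sequences -/

/-- Laguerre's identity at `0`: the product is a nonpositive multiple of the sum of `r⁻²` over the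
roots, which vanishes only if there are none. -/
theorem coeff_zero_mul_coeff_two_nonpos {p : ℝ[X]} (hp : p.Splits) (h0 : p.coeff 0 ≠ 0)
    (h1 : p.coeff 1 = 0) :
    p.coeff 0 * p.coeff 2 ≤ 0 ∧ (p.coeff 0 * p.coeff 2 = 0 → p.natDegree = 0) := by
  have key := eval_laguerre hp (t := 0) (by rwa [← coeff_zero_eq_eval_zero])
  simp only [← coeff_zero_eq_eval_zero, coeff_derivative, h1, zero_sub, neg_sq] at key
  norm_num [h1] at key
  have hr : ∀ r ∈ p.roots, r ≠ 0 := by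
    rintro r hr rfl
    rw [coeff_zero_eq_eval_zero] at h0
    exact h0 (isRoot_of_mem_roots hr)
  have hnn : ∀ x ∈ p.roots.map fun r => (r ^ 2)⁻¹, 0 ≤ x := by
    intro x hx
    obtain ⟨y, -, rfl⟩ := Multiset.mem_map.1 hx
    positivity
  have hS := Multiset.sum_nonneg hnn
  have hp0 : 0 < p.coeff 0 ^ 2 := by positivity
  refine ⟨by nlinarith [mul_nonneg hp0.le hS], fun h => ?_⟩
  have hS0 : (p.roots.map fun r => (r ^ 2)⁻¹).sum = 0 := by
    have : p.coeff 0 ^ 2 * (p.roots.map fun r => (r ^ 2)⁻¹).sum = 0 := by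
      rw [← key]; linear_combination (-2) * h
    exact (mul_eq_zero.1 this).resolve_left hp0.ne'
  rw [hp.natDegree_eq_card_roots, Multiset.card_eq_zero]
  refine Multiset.eq_zero_of_forall_notMem fun r hrm => ?_
  have h1 := Multiset.single_le_sum hnn _ (Multiset.mem_map_of_mem (fun r => (r ^ 2)⁻¹) hrm)
  rw [hS0] at h1
  have h2 := hr r hrm
  have : 0 < (r ^ 2)⁻¹ := by positivity
  linarith

theorem IsMultiplierSequence.zero_mul_two_nonneg {α : ℕ → ℝ} (hα : IsMultiplierSequence α) :
    0 ≤ α 0 * α 2 := by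
  rcases eq_or_ne (α 0) 0 with h | h
  · simp [h]
  have hs : (1 - X ^ 2 : ℝ[X]).Splits := by
    have : (1 - X ^ 2 : ℝ[X]) = (1 + X) ^ 1 * -(X - C 1) := by rw [C_1]; ring
    rw [this]
    exact (splits_one_add_X_pow 1).mul (Splits.X_sub_C 1).neg
  have h0 : (1 - X ^ 2 : ℝ[X]).coeff 0 = 1 := by simp [coeff_one, coeff_X_pow]
  have h1 : (1 - X ^ 2 : ℝ[X]).coeff 1 = 0 := by simp [coeff_one, coeff_X_pow]
  have h2 : (1 - X ^ 2 : ℝ[X]).coeff 2 = -1 := by simp [coeff_one, coeff_X_pow]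
  have := (coeff_zero_mul_coeff_two_nonpos (hα _ hs)
    (by rw [coeff_diagonalOperator, h0]; simpa using h)
    (by rw [coeff_diagonalOperator, h1, mul_zero])).1
  rw [coeff_diagonalOperator, coeff_diagonalOperator, h0, h2] at this
  linarith

/-- The image of `(1 + X) ^ k` has no linear term, and its outer coefficients of degrees `0` and `2`
have product both `≥ 0` and `≤ 0`; so it is constant. -/
theorem IsMultiplierSequence.eq_zero_of_one_eq_zero {α : ℕ → ℝ} (hα : IsMultiplierSequence α)
    (h0 : α 0 ≠ 0) (h1 : α 1 = 0) {k : ℕ} (hk : 1 ≤ k) : α k = 0 := by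
  have hc : ∀ i, (diagonalOperator α ((1 + X) ^ k)).coeff i = α i * k.choose i := fun i => by
    rw [coeff_diagonalOperator, coeff_one_add_X_pow]
  obtain ⟨h2, h3⟩ := coeff_zero_mul_coeff_two_nonpos (hα _ (splits_one_add_X_pow k))
    (by simpa [hc] using h0) (by simp [hc, h1])
  have h4 : 0 ≤ α 0 * α 2 * k.choose 2 := mul_nonneg hα.zero_mul_two_nonneg (Nat.cast_nonneg _)
  simp only [hc, Nat.choose_zero_right, Nat.cast_one, mul_one] at h2 h3
  have h5 := h3 (by linarith)
  have := coeff_eq_zero_of_natDegree_lt (p := diagonalOperator α ((1 + X) ^ k)) (n := k) (by omega)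
  simpa [hc] using this

theorem IsMultiplierSequence.zero_mul_nonneg {α : ℕ → ℝ} (hα : IsMultiplierSequence α)
    (h0 : α 0 ≠ 0) : ∃ s : ℝ, (s = 1 ∨ s = -1) ∧ ∀ i, 0 ≤ α 0 * α i * s ^ i := by
  -- There are no gaps: after a zero everything vanishes. Hence `α i * α (i + 2) ≥ 0` carries signs
  -- along in steps of two, and `s` is fixed by `α 0 * α 1`.
  have hz : ∀ i k, i ≤ k → α i = 0 → α k = 0 := by
    intro i
    induction i with
    | zero => exact fun k _ h => absurd h h0
    | succ i ih =>
      intro k hk h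
      by_cases hi : α i = 0
      · exact ih k (by omega) hi
      · have := (hα.shift i).eq_zero_of_one_eq_zero (k := k - i) (by simpa using hi) h (by omega)
        rwa [show i + (k - i) = k by omega] at this
  obtain ⟨s, hs, h1⟩ : ∃ s : ℝ, (s = 1 ∨ s = -1) ∧ 0 ≤ α 0 * α 1 * s := by
    rcases le_total 0 (α 0 * α 1) with h | h
    · exact ⟨1, .inl rfl, by linarith⟩
    · exact ⟨-1, .inr rfl, by linarith⟩
  have hss := sq_eq_one_of_sign hs
  refine ⟨s, hs, fun i => ?_⟩
  induction i using Nat.twoStepInduction with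
  | zero => simpa using mul_self_nonneg (α 0)
  | one => simpa using h1
  | more i ih _ =>
    have e : s ^ (i + 2) = s ^ i := by rw [pow_add, pow_two, hss, mul_one]
    rw [e]
    by_cases hi : α i = 0
    · rw [hz i (i + 2) (by omega) hi]; simp
    · have h2 := (hα.shift i).zero_mul_two_nonneg
      simp only [add_zero] at h2
      have hs0 : s ≠ 0 := by rintro rfl; simp at hss
      have hpos : 0 < α 0 * α i * s ^ i := lt_of_le_of_ne ih (by positivity)
      refine nonneg_of_mul_nonneg_right ?_ hpos
      calc 0 ≤ (α 0 * s ^ i) ^ 2 * (α i * α (i + 2)) := by positivity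
        _ = _ := by ring

theorem IsMultiplierSequence.exists_sign {α : ℕ → ℝ} (hα : IsMultiplierSequence α) :
    ∃ s : ℝ, (s = 1 ∨ s = -1) ∧ ∀ i j, 0 ≤ α i * α j * s ^ (i + j) := by
  by_cases h : ∃ n, α n ≠ 0
  · classical
    -- Shifting past the leading zeros makes the initial entry nonzero.
    set n := Nat.find h with hn
    have hn0 : α n ≠ 0 := Nat.find_spec h
    have hlt : ∀ i < n, α i = 0 := fun i hi => not_not.1 (Nat.find_min h hi)
    obtain ⟨s, hs, hs'⟩ := (hα.shift n).zero_mul_nonneg (by simpa using hn0)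
    have hss := sq_eq_one_of_sign hs
    refine ⟨s, hs, fun i j => ?_⟩
    rcases lt_or_ge i n with hi | hi
    · simp [hlt i hi]
    rcases lt_or_ge j n with hj | hj
    · simp [hlt j hj]
    obtain ⟨i, rfl⟩ := Nat.exists_eq_add_of_le hi
    obtain ⟨j, rfl⟩ := Nat.exists_eq_add_of_le hj
    have h1 := mul_nonneg (hs' i) (hs' j)
    simp only [add_zero] at h1
    refine nonneg_of_mul_nonneg_right (a := α n ^ 2) ?_ (by positivity)
    have e : s ^ (n + i + (n + j)) = s ^ i * s ^ j := by
      rw [show n + i + (n + j) = (n + n) + i + j by ring, pow_add, pow_add, pow_add, ← mul_pow, hss,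
        one_pow, one_mul]
    rw [e]
    exact h1.trans_eq (by ring)
  · push Not at h
    exact ⟨1, .inl rfl, by simp [h]⟩

/-- At a nonzero point of sign `s` all terms of the polynomial have the same sign, so a root there
would kill every coefficient. Roots therefore have sign `-s`, for all `k` at once. -/
theorem IsMultiplierSequence.roots_finitePoly {α : ℕ → ℝ} (hα : IsMultiplierSequence α) :
    ∃ σ : ℝ, (σ = 1 ∨ σ = -1) ∧
      ∀ k, ∀ r ∈ (finitePoly (truncation α k)).roots, r = σ * |r| := by
  obtain ⟨s, hs, h⟩ := hα.exists_sign
  have hss := sq_eq_one_of_sign hs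
  have hs0 : s ≠ 0 := by rintro rfl; simp at hss
  refine ⟨-s, by rcases hs with rfl | rfl <;> simp, fun k r hr => ?_⟩
  by_contra hne
  have hr0 : r ≠ 0 := by rintro rfl; simp at hne
  have hrs : r = s * |r| := by
    rcases hs with rfl | rfl <;> rcases abs_cases r with ⟨h, _⟩ | ⟨h, _⟩ <;> rw [h] at hne ⊢ <;>
      simp at hne ⊢
  have hP0 : finitePoly (truncation α k) ≠ 0 := by
    intro h; rw [h] at hr; simp at hr
  have hroot : ∑ j : Fin (k + 1), (k.choose j : ℝ) * α j * r ^ (j : ℕ) = 0 := by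
    have := (mem_roots hP0).1 hr
    rw [IsRoot, finitePoly, eval_finsetSum] at this
    simpa [truncation] using this
  apply hP0
  rw [finitePoly]
  refine Finset.sum_eq_zero fun i _ => ?_
  -- Multiplying the root equation by `α i * s ^ i` makes all terms nonnegative; the term `j = i`
  -- then gives `α i = 0`.
  have hsum : ∑ j : Fin (k + 1),
      (k.choose j : ℝ) * |r| ^ (j : ℕ) * (α i * α j * s ^ ((i : ℕ) + j)) = 0 := by
    have : ∀ j : Fin (k + 1), (k.choose j : ℝ) * |r| ^ (j : ℕ) * (α i * α j * s ^ ((i : ℕ) + j)) =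
        α i * s ^ (i : ℕ) * ((k.choose j : ℝ) * α j * r ^ (j : ℕ)) := by
      intro j
      conv_rhs => rw [hrs, mul_pow]
      ring
    rw [Finset.sum_congr rfl fun j _ => this j, ← Finset.mul_sum, hroot, mul_zero]
  have hz := (Finset.sum_eq_zero_iff_of_nonneg fun (j : Fin (k + 1)) _ =>
    mul_nonneg (by positivity) (h i j)).1 hsum i (Finset.mem_univ i)
  have hch : (k.choose i : ℝ) ≠ 0 := by
    exact_mod_cast (Nat.choose_pos (Nat.lt_succ_iff.1 i.2)).ne'
  have : α i = 0 := by simpa [hch, hr0, hs0] using hz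
  simp [truncation, this]

/-! ### Monotonicity of the logarithmic mesh -/

theorem absRoots_nonneg (P : ℝ[X]) (i : Fin (absRoots P).length) : 0 ≤ (absRoots P)[i] := by
  have h : (absRoots P)[i] ∈ (P.roots.map fun x => |x|).sort (· ≤ ·) := List.getElem_mem _
  rw [Multiset.mem_sort, Multiset.mem_map] at h
  obtain ⟨r, -, hr⟩ := h
  rw [← hr]
  exact abs_nonneg r

theorem absRoots_monotone (P : ℝ[X]) :
    Monotone fun i : Fin (absRoots P).length => (absRoots P)[i] := by
  intro i j hij
  rcases hij.eq_or_lt with rfl | h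
  · exact le_rfl
  · exact List.pairwise_iff_getElem.1 (Multiset.pairwise_sort _ (· ≤ ·)) i j i.2 j.2 h

theorem eq_C_mul_prod_absRoots {P : ℝ[X]} (hP : P.Splits) {σ : ℝ}
    (h : ∀ r ∈ P.roots, r = σ * |r|) :
    P = C P.leadingCoeff *
      ∏ i : Fin (absRoots P).length, (X - C (σ * (absRoots P)[i])) := by
  have e : ∏ i : Fin (absRoots P).length, (X - C (σ * (absRoots P)[i])) =
      (P.roots.map fun r => X - C r).prod := by
    have := Fin.prod_univ_fun_getElem (absRoots P) fun y => X - C (σ * y)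
    simp only [Fin.getElem_fin] at this ⊢
    rw [this, ← Multiset.prod_coe, ← Multiset.map_coe, absRoots, Multiset.sort_eq, Multiset.map_map]
    congr 1
    exact Multiset.map_congr rfl fun r hr => by rw [Function.comp_apply, ← h r hr]
  rw [e]
  exact hP.eq_prod_roots

/-- Diagonal hyperbolicity preservers do not decrease the logarithmic mesh. -/
theorem lmesh_le_lmesh_diagonalOperator {β : ℕ → ℝ} (hβ : IsMultiplierSequence β) {P : ℝ[X]}
    (hP : P.Splits) {σ τ : ℝ} (hσ : σ = 1 ∨ σ = -1) (hτ : τ = 1 ∨ τ = -1)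
    (hPσ : ∀ r ∈ P.roots, r = σ * |r|) (hQτ : ∀ r ∈ (diagonalOperator β P).roots, r = τ * |r|) :
    lmesh P ≤ lmesh (diagonalOperator β P) := by
  set Q := diagonalOperator β P with hQ
  refine le_iInf fun j => le_iInf fun hj => le_iInf fun hj0 => le_of_forall_lt fun c hc => ?_
  -- A real `q` strictly below the mesh handles the value `⊤` and supplies the strict separation
  -- that the pencil criterion needs.
  obtain ⟨q, hcq, hqP⟩ := EReal.lt_iff_exists_real_btwn.1 hc
  refine hcq.trans_le (EReal.coe_le_coe_iff.2 ?_)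
  have hQ0 : Q ≠ 0 := by
    intro h
    rw [absRoots, h] at hj
    simp at hj
  have hjpos : 0 < (absRoots Q)[j] :=
    lt_of_le_of_ne (absRoots_nonneg Q ⟨j, by omega⟩) (Ne.symm hj0)
  have hjle : (absRoots Q)[j] ≤ (absRoots Q)[j + 1] :=
    absRoots_monotone Q (a := ⟨j, by omega⟩) (b := ⟨j + 1, hj⟩) (by simp [Fin.le_def])
  rcases le_or_gt q 1 with hq1 | hq1
  · exact hq1.trans ((one_le_div hjpos).2 hjle)
  rw [le_div_iff₀ hjpos]
  have hsep : ∀ r, r < q → ∀ a b : Fin (absRoots P).length, a < b → (absRoots P)[a] ≠ 0 →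
      r * (absRoots P)[a] < (absRoots P)[b] := by
    intro r hrq a b hab ha
    have hab' : (a : ℕ) + 1 ≤ b := hab
    have hlen : (a : ℕ) + 1 < (absRoots P).length := by omega
    have h1 : lmesh P ≤ (((absRoots P)[(a : ℕ) + 1] / (absRoots P)[(a : ℕ)] : ℝ) : EReal) :=
      iInf_le_of_le (a : ℕ) (iInf_le_of_le hlen (iInf_le_of_le ha le_rfl))
    have h2 := EReal.coe_lt_coe_iff.1 (hqP.trans_le h1)
    have hapos : 0 < (absRoots P)[a] := lt_of_le_of_ne (absRoots_nonneg P a) (Ne.symm ha)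
    have h3 := (lt_div_iff₀ hapos).1 h2
    have h4 : (absRoots P)[(a : ℕ) + 1] ≤ (absRoots P)[b] :=
      absRoots_monotone P (a := ⟨(a : ℕ) + 1, hlen⟩) (b := b) hab'
    nlinarith
  refine separated_of_splits_pencil hτ (leadingCoeff_ne_zero.2 hQ0) (absRoots_nonneg Q)
    (absRoots_monotone Q) (eq_C_mul_prod_absRoots (hβ P hP) hQτ) (fun r hr1 hrq c => ?_)
    ⟨j, by omega⟩ ⟨j + 1, hj⟩ (by simp [Fin.lt_def]) hj0
  have h1 := (splits_pencil_of_separated hr1 hσ (absRoots_nonneg P) (absRoots_monotone P)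
    (hsep r hrq) c 1).C_mul P.leadingCoeff
  have h2 := hβ _ h1
  have e : C P.leadingCoeff *
      (C c * ∏ i : Fin (absRoots P).length, (X - C (σ * (absRoots P)[i])) +
      C 1 * (∏ i : Fin (absRoots P).length, (X - C (σ * (absRoots P)[i]))).comp (C r * X)) =
      P.comp (C r * X) + c • P := by
    conv_rhs => rw [eq_C_mul_prod_absRoots hP hPσ]
    rw [smul_eq_C_mul, mul_comp, C_comp, C_1]
    ring
  rw [e, map_add, map_smul, diagonalOperator_comp_C_mul_X, smul_eq_C_mul] at h2
  exact h2

theorem lmeshSeq_le_lmeshSeq_mul {A B : ℕ → ℝ} (hA : IsMultiplierSequence A)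
    (hB : IsMultiplierSequence B) : lmeshSeq A ≤ lmeshSeq fun n => A n * B n := by
  obtain ⟨σ, hσ, hσ'⟩ := hA.roots_finitePoly
  obtain ⟨τ, hτ, hτ'⟩ := (hA.mul hB).roots_finitePoly
  refine iInf_mono fun k => ?_
  have e : finitePoly (truncation (fun n => A n * B n) k) =
      diagonalOperator B (finitePoly (truncation A k)) := by
    rw [finitePoly_truncation, finitePoly_truncation, diagonalOperator_diagonalOperator]
  have hτk := hτ' k
  rw [lmeshFinite, lmeshFinite]
  rw [e] at hτk ⊢
  exact lmesh_le_lmesh_diagonalOperator hB (hA.splits_finitePoly k) hσ hτ (hσ' k) hτk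

end LogMesh

theorem mainTheorem4 (A B : ℕ → ℝ)
    (hA : LogMesh.IsMultiplierSequence A) (hB : LogMesh.IsMultiplierSequence B) :
    max (LogMesh.lmeshSeq A) (LogMesh.lmeshSeq B) ≤ LogMesh.lmeshSeq (fun n => A n * B n) := by
  refine max_le (LogMesh.lmeshSeq_le_lmeshSeq_mul hA hB) ?_
  have e : (fun n => A n * B n) = fun n => B n * A n := funext fun n => mul_comm _ _
  rw [e]
  exact LogMesh.lmeshSeq_le_lmeshSeq_mul hB hA
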